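/- **Proposition (Cauchy-like identity for Hall–Littlewood $S$-functions).** Let $t\in\mathbb C$ and let $X=\{x_1,x_2,\dots\}$, $Y=\{y_1,y_2,\dots\}$ be two independent countable alphabets of commuting indeterminates, with product alphabet $XY=\{x_iy_j\}_{i,j\ge 1}$. In a finite alphabet $x_1,\dots,x_k$ put, for $n>0$, $$q_n(x_1,\dots,x_k;t)=(1-t)\sum_{i}x_i^n\prod_{j\ne i}\frac{x_i-tx_j}{x_i-x_j},$$ which is a polynomial, and let $q_n(X;t)$ be the limit of these polynomials as $k\to\infty$; put $q_0(X;t)=1$ and $q_n(X;t)=0$ for $n<0$. Let $q_n(XY;t)$ denote the formal power series in $X\cup Y$ obtained in the same way from the alphabet $XY$ (that is, $q_n$ in a countable alphabet $\{z_{ij}\}_{i,j\ge 1}$ with $z_{ij}=x_iy_j$ substituted). For a partition $\lambda$ with $\ell(\lambda)$ parts let $$S_\lambda(Y;t)=\det\bigl(q_{\lambda_i-i+j}(Y;t)\bigr)_{1\le i,j\le \ell(\lambda)}$$ be the Hall–Littlewood $S$-function, and let $s_\lambda(X)=\sum_T x^T$ be the Schur function, where $T$ runs over the semistandard Young tableaux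 of shape $\lambda$ and $x^T=\prod_{c\in\lambda}x_{T(c)}$. Then, for every integer $n\ge 0$, $$q_n(XY;t)=\sum_{\lambda\vdash n}s_\lambda(X)\,S_\lambda(Y;t)$$ as formal power series in $X\cup Y$ with complex coefficients. -/

import Mathlib

noncomputable section

/-! ### The symmetric functions `q_n(X;t)` -/

namespace HallLittlewood

open scoped Classical in
/-- The expression `(1 - t) ∑_i x_i ^ n ∏_{j ≠ i} (x_i - t x_j) / (x_i - x_j)`, for a finite family
of elements `x_i` (`i ∈ s`) of a field. -/
def qFormula {K ι : Type*} [Field K] (t : K) (x : ι → K) (s : Finset ι) (n : ℕ) : K :=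
  (1 - t) * ∑ i ∈ s, x i ^ n * ∏ j ∈ s.erase i, (x i - t * x j) / (x i - x j)

/-- The indeterminate `x_i`, as a rational function. -/
def ratVar (ι : Type*) (i : ι) : FractionRing (MvPolynomial ι ℂ) :=
  algebraMap (MvPolynomial ι ℂ) (FractionRing (MvPolynomial ι ℂ)) (MvPolynomial.X i)

/-- The rational function `(1 - t) ∑_i x_i ^ n ∏_{j ≠ i} (x_i - t x_j) / (x_i - x_j)` in the
indeterminates `x_i`, `i ∈ s`. -/
def qRat {ι : Type*} (t : ℂ) (s : Finset ι) (n : ℕ) : FractionRing (MvPolynomial ι ℂ) :=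
  qFormula (algebraMap ℂ (FractionRing (MvPolynomial ι ℂ)) t) (ratVar ι) s n

/-! The rational function `qRat t s n` is a polynomial for `n > 0`. -/

theorem qFormula_partialFractions {K ι : Type*} [Field K] [DecidableEq ι] (t : K) (x : ι → K)
    (s : Finset ι) (hx : Set.InjOn x s) (y : K) (hy : ∀ i ∈ s, x i ≠ y) :
    (1 - t) * ∑ i ∈ s, (x i / (x i - y)) * ∏ j ∈ s.erase i, (x i - t * x j) / (x i - x j)
      + ∏ j ∈ s, (y - t * x j) / (y - x j) = 1 := by
  classical
  have hdeg : (∏ j ∈ s, (Polynomial.X - Polynomial.C (t * x j))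
      - ∏ j ∈ s, (Polynomial.X - Polynomial.C (x j))).degree < (s.card : WithBot ℕ) := by
    rcases s.eq_empty_or_nonempty with rfl | hs
    · simp
    have h1 := Lagrange.degree_nodal (s := s) (v := fun j => t * x j)
    have h2 := Lagrange.degree_nodal (s := s) (v := x)
    have h3 := Lagrange.nodal_monic (s := s) (v := fun j => t * x j)
    have h4 := Lagrange.nodal_monic (s := s) (v := x)
    rw [Lagrange.nodal_eq] at h1 h2 h3 h4
    have := Polynomial.degree_sub_lt_left (h1.trans h2.symm) h3.ne_zero
      (by rw [h3.leadingCoeff, h4.leadingCoeff])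
    rwa [h1] at this
  have key := Lagrange.eq_interpolate hx hdeg
  have key2 := congrArg (Polynomial.eval y) key
  simp only [Lagrange.interpolate_apply, Polynomial.eval_sub, Polynomial.eval_prod,
    Polynomial.eval_X, Polynomial.eval_C, Polynomial.eval_finsetSum, Polynomial.eval_mul,
    Lagrange.basis, Lagrange.basisDivisor] at key2
  have hne : ∏ j ∈ s, (y - x j) ≠ 0 :=
    Finset.prod_ne_zero_iff.2 fun j hj => sub_ne_zero.2 (hy j hj).symm
  have hs : ∀ i ∈ s, (∏ j ∈ s, (x i - t * x j) - ∏ j ∈ s, (x i - x j)) *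
        ∏ j ∈ s.erase i, (x i - x j)⁻¹ * (y - x j)
      = - (∏ j ∈ s, (y - x j)) *
        ((1 - t) * ((x i / (x i - y)) * ∏ j ∈ s.erase i, (x i - t * x j) / (x i - x j))) := by
    intro i hi
    rw [← Finset.mul_prod_erase s (fun j => x i - t * x j) hi,
      ← Finset.mul_prod_erase s (fun j => x i - x j) hi,
      ← Finset.mul_prod_erase s (fun j => y - x j) hi, Finset.prod_mul_distrib,
      Finset.prod_div_distrib, Finset.prod_inv_distrib, sub_self, zero_mul, sub_zero]
    have h1 : x i - y ≠ 0 := sub_ne_zero.2 (hy i hi)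
    have h2 : ∏ j ∈ s.erase i, (x i - x j) ≠ 0 := by
      refine Finset.prod_ne_zero_iff.2 fun j hj => sub_ne_zero.2 fun h => ?_
      exact (Finset.ne_of_mem_erase hj) (hx (Finset.mem_of_mem_erase hj) hi h.symm)
    field_simp
    ring
  rw [Finset.sum_congr rfl hs, ← Finset.mul_sum, ← Finset.mul_sum] at key2
  rw [Finset.prod_div_distrib]
  generalize ∑ i ∈ s, (x i / (x i - y)) * ∏ j ∈ s.erase i, (x i - t * x j) / (x i - x j) = A at *
  rw [← eq_sub_iff_add_eq', div_eq_iff hne]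
  linear_combination key2

theorem qFormula_insert {K ι : Type*} [Field K] [DecidableEq ι] (t : K) (x : ι → K)
    (s : Finset ι) (a : ι) (ha : a ∉ s) (hx : Set.InjOn x (insert a s : Finset ι)) (n : ℕ) :
    qFormula t x (insert a s) (n + 1) = qFormula t x s (n + 1)
      + (1 - t) * ∑ m ∈ Finset.range n, x a ^ (n - m) * qFormula t x s (m + 1)
      + (1 - t) * x a ^ (n + 1) := by
  classical
  have hxs : Set.InjOn x s := hx.mono (by simp)
  have hxa : ∀ i ∈ s, x i ≠ x a := fun i hi h =>
    ha (hx (by simp [hi]) (by simp) h ▸ hi)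
  have pf := qFormula_partialFractions t x s hxs (x a) hxa
  have hdec : ∀ (s : Finset ι) (m : ℕ), qFormula t x s m
      = (1 - t) * ∑ i ∈ s, x i ^ m * ∏ j ∈ s.erase i, (x i - t * x j) / (x i - x j) := by
    intro s m
    unfold qFormula
    congr! 5
  simp only [hdec]
  rw [Finset.sum_insert ha, Finset.erase_insert ha]
  have hs : ∀ i ∈ s, x i ^ (n + 1) *
        ∏ j ∈ (insert a s).erase i, (x i - t * x j) / (x i - x j)
      = (x i ^ (n + 1) + (1 - t) * ∑ m ∈ Finset.range n, x a ^ (n - m) * x i ^ (m + 1)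
          + (1 - t) * x a ^ (n + 1) * (x i / (x i - x a))) *
        ∏ j ∈ s.erase i, (x i - t * x j) / (x i - x j) := by
    intro i hi
    have hia : a ≠ i := fun h => ha (h ▸ hi)
    rw [Finset.erase_insert_of_ne hia, Finset.prod_insert (by simp [ha]), ← mul_assoc]
    congr 1
    have h1 : x i - x a ≠ 0 := sub_ne_zero.2 (hxa i hi)
    have geo : (∑ m ∈ Finset.range n, x a ^ (n - m) * x i ^ (m + 1)) * (x i - x a)
        = x a * x i * (x i ^ n - x a ^ n) := by
      rw [← geom_sum₂_mul, ← mul_assoc, Finset.mul_sum]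
      congr 1
      refine Finset.sum_congr rfl fun m hm => ?_
      have : n - m = (n - 1 - m) + 1 := by have := Finset.mem_range.1 hm; omega
      rw [this]
      ring
    field_simp
    linear_combination (-(1 - t)) * geo
  rw [Finset.sum_congr rfl hs]
  have hsplit : ∑ i ∈ s, (x i ^ (n + 1)
          + (1 - t) * ∑ m ∈ Finset.range n, x a ^ (n - m) * x i ^ (m + 1)
          + (1 - t) * x a ^ (n + 1) * (x i / (x i - x a))) *
        ∏ j ∈ s.erase i, (x i - t * x j) / (x i - x j)
      = ∑ i ∈ s, x i ^ (n + 1) * ∏ j ∈ s.erase i, (x i - t * x j) / (x i - x j)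
        + (1 - t) * ∑ m ∈ Finset.range n, x a ^ (n - m) *
            ∑ i ∈ s, x i ^ (m + 1) * ∏ j ∈ s.erase i, (x i - t * x j) / (x i - x j)
        + (1 - t) * x a ^ (n + 1) * ∑ i ∈ s, (x i / (x i - x a)) *
            ∏ j ∈ s.erase i, (x i - t * x j) / (x i - x j) := by
    simp only [add_mul, Finset.sum_add_distrib, Finset.mul_sum, Finset.sum_mul]
    rw [Finset.sum_comm (s := s)]
    simp only [mul_assoc]
  have hcomm : ∑ m ∈ Finset.range n, x a ^ (n - m) * ((1 - t) *
            ∑ i ∈ s, x i ^ (m + 1) * ∏ j ∈ s.erase i, (x i - t * x j) / (x i - x j))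
      = (1 - t) * ∑ m ∈ Finset.range n, x a ^ (n - m) *
            ∑ i ∈ s, x i ^ (m + 1) * ∏ j ∈ s.erase i, (x i - t * x j) / (x i - x j) := by
    rw [Finset.mul_sum]
    exact Finset.sum_congr rfl fun m _ => by ring
  rw [hsplit, hcomm]
  linear_combination (1 - t) * x a ^ (n + 1) * pf

theorem ratVar_injective (ι : Type*) : Function.Injective (ratVar ι) := fun _ _ h =>
  MvPolynomial.X_injective (IsFractionRing.injective (MvPolynomial ι ℂ) _ h)

theorem exists_qPoly {ι : Type*} (t : ℂ) (s : Finset ι) (n : ℕ) :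
    ∃ P : MvPolynomial ι ℂ, algebraMap _ (FractionRing (MvPolynomial ι ℂ)) P
      = qRat t s (n + 1) := by
  classical
  induction s using Finset.induction_on generalizing n with
  | empty => exact ⟨0, by simp [qRat, qFormula]⟩
  | insert a s ha ih =>
    choose P hP using ih
    refine ⟨P n + (1 - MvPolynomial.C t) *
        ∑ m ∈ Finset.range n, MvPolynomial.X a ^ (n - m) * P m
      + (1 - MvPolynomial.C t) * MvPolynomial.X a ^ (n + 1), ?_⟩
    rw [qRat, qFormula_insert _ _ _ _ ha ((ratVar_injective ι).injOn)]
    simp only [map_add, map_mul, map_sub, map_one, map_sum, map_pow, hP]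
    rw [IsScalarTower.algebraMap_apply ℂ (MvPolynomial ι ℂ)]
    rfl

/-- The polynomial `q_n(x_i, i ∈ s; t)`, for `n > 0`: the polynomial equal to the rational function
`(1 - t) ∑_i x_i ^ n ∏_{j ≠ i} (x_i - t x_j) / (x_i - x_j)`. It is written for `n + 1`. -/
def qPolySucc {ι : Type*} (t : ℂ) (s : Finset ι) (n : ℕ) : MvPolynomial ι ℂ :=
  (exists_qPoly t s n).choose

theorem algebraMap_qPolySucc {ι : Type*} (t : ℂ) (s : Finset ι) (n : ℕ) :
    algebraMap _ (FractionRing (MvPolynomial ι ℂ)) (qPolySucc t s n) = qRat t s (n + 1) :=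
  (exists_qPoly t s n).choose_spec

theorem qPolySucc_insert {ι : Type*} [DecidableEq ι] (t : ℂ) (s : Finset ι) (a : ι) (ha : a ∉ s)
    (n : ℕ) :
    qPolySucc t (insert a s) n = qPolySucc t s n + (1 - MvPolynomial.C t) *
        ∑ m ∈ Finset.range n, MvPolynomial.X a ^ (n - m) * qPolySucc t s m
      + (1 - MvPolynomial.C t) * MvPolynomial.X a ^ (n + 1) := by
  apply IsFractionRing.injective (MvPolynomial ι ℂ) (FractionRing (MvPolynomial ι ℂ))
  rw [algebraMap_qPolySucc, qRat, qFormula_insert _ _ _ _ ha ((ratVar_injective ι).injOn)]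
  simp only [map_add, map_mul, map_sub, map_one, map_sum, map_pow, algebraMap_qPolySucc]
  rw [IsScalarTower.algebraMap_apply ℂ (MvPolynomial ι ℂ)]
  rfl

/-- `q_n(X;t)` in the (possibly infinite) alphabet `X = (x_i)_{i ∈ ι}`, as a formal power series,
for `n ∈ ℤ`: it is `1` for `n = 0` and `0` for `n < 0`. For `n > 0` it is the limit of the
polynomials `q_n(x_i, i ∈ s; t)` as the finite set `s` grows: the coefficient of a monomial `x ^ d`
is its coefficient in `q_n(x_i, i ∈ s; t)` for all finite `s` that contain the variables of `x ^ d`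
(see `coeff_q`), in particular for the set `s` of these variables. -/
def q (ι : Type*) (t : ℂ) : ℤ → MvPowerSeries ι ℂ
  | Int.ofNat 0 => 1
  | Int.ofNat (n + 1) => fun d => (qPolySucc t d.support n).coeff d
  | Int.negSucc _ => 0

theorem coeff_q {ι : Type*} (t : ℂ) (n : ℕ) (d : ι →₀ ℕ) (s : Finset ι) (hs : d.support ⊆ s) :
    MvPowerSeries.coeff d (q ι t ((n + 1 : ℕ) : ℤ)) = (qPolySucc t s n).coeff d := by
  classical
  change (qPolySucc t d.support n).coeff d = _
  have key : ∀ u : Finset ι, Disjoint d.support u →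
      (qPolySucc t (u ∪ d.support) n).coeff d = (qPolySucc t d.support n).coeff d := by
    intro u
    induction u using Finset.induction_on with
    | empty => simp
    | insert a u ha ih =>
      intro hd
      rw [Finset.disjoint_insert_right] at hd
      rw [Finset.insert_union, qPolySucc_insert _ _ _ (by simp [ha, hd.1] : a ∉ u ∪ d.support),
        MvPolynomial.coeff_add, MvPolynomial.coeff_add, ih hd.2]
      have hX : ∀ P : MvPolynomial ι ℂ, (MvPolynomial.X a * P).coeff d = 0 := fun P => by
        rw [MvPolynomial.coeff_X_mul', if_neg hd.1]
      have h1 : (1 - MvPolynomial.C t) * ∑ m ∈ Finset.range n,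
            MvPolynomial.X a ^ (n - m) * qPolySucc t (u ∪ d.support) m
          = MvPolynomial.X a * ((1 - MvPolynomial.C t) * ∑ m ∈ Finset.range n,
            MvPolynomial.X a ^ (n - m - 1) * qPolySucc t (u ∪ d.support) m) := by
        rw [mul_left_comm, Finset.mul_sum _ _ (MvPolynomial.X a)]
        congr 1
        refine Finset.sum_congr rfl fun m hm => ?_
        rw [← mul_assoc, ← pow_succ', show n - m - 1 + 1 = n - m by
          have := Finset.mem_range.1 hm; omega]
      have h2 : (1 - MvPolynomial.C t) * MvPolynomial.X a ^ (n + 1)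
          = MvPolynomial.X a * ((1 - MvPolynomial.C t) * MvPolynomial.X a ^ n) := by ring
      rw [h1, h2, hX, hX, add_zero, add_zero]
  rw [← key (s \ d.support) Finset.disjoint_sdiff, Finset.sdiff_union_of_subset hs]

/-- The Hall-Littlewood `S`-function `S_λ(X;t) = det (q_{λ_i - i + j}(X;t))_{1 ≤ i, j ≤ ℓ(λ)}`. -/
def S (ι : Type*) (t : ℂ) (μ : YoungDiagram) : MvPowerSeries ι ℂ :=
  Matrix.det (Matrix.of fun i j : Fin (μ.colLen 0) =>
    q ι t ((μ.rowLen i : ℤ) - (i : ℤ) + (j : ℤ)))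

end HallLittlewood

/-! ### Schur functions -/

/-- The exponent of the monomial `x ^ T`: the number of cells of `T` with entry `k`, for each `k`. -/
def SemistandardYoungTableau.content {μ : YoungDiagram} (T : SemistandardYoungTableau μ) : ℕ →₀ ℕ :=
  ∑ c ∈ μ.cells, Finsupp.single (T c.1 c.2) 1

theorem SemistandardYoungTableau.finite_content_eq (μ : YoungDiagram) (d : ℕ →₀ ℕ) :
    {T : SemistandardYoungTableau μ | T.content = d}.Finite := by
  classical
  let F : SemistandardYoungTableau μ → (μ.cells → ℕ) := fun T c => T c.1.1 c.1.2
  have hF : Function.Injective F := by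
    intro T T' h
    ext i j
    by_cases hc : (i, j) ∈ μ
    · exact congrFun h ⟨(i, j), hc⟩
    · rw [T.zeros hc, T'.zeros hc]
  refine Set.Finite.of_finite_image (f := F) ?_ hF.injOn
  refine (Set.Finite.pi' (t := fun _ => (d.support : Set ℕ))
    fun _ => d.support.finite_toSet).subset ?_
  rintro _ ⟨T, rfl, rfl⟩ c
  simp only [Finset.mem_coe, Finsupp.mem_support_iff, SemistandardYoungTableau.content,
    Finsupp.finsetSum_apply]
  refine (Finset.sum_pos' (fun _ _ => Nat.zero_le _) ⟨c.1, c.2, ?_⟩).ne'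
  simp [F]

/-- The Schur function `s_λ(X) = ∑_T x ^ T`, the sum over all semistandard Young tableaux of shape
`λ`, in the alphabet `X = {x_0, x_1, x_2, …}`: the coefficient of `x ^ d` is the number of
semistandard Young tableaux of shape `λ` and content `d` (there are finitely many). -/
def schurFunction (μ : YoungDiagram) : MvPowerSeries ℕ ℂ := fun d =>
  ({T : SemistandardYoungTableau μ | T.content = d}.ncard : ℂ)

/-- The Young diagram of a partition `λ` of `n`: its rows have lengths `λ_1 ≥ λ_2 ≥ ⋯`. -/
def Nat.Partition.youngDiagram {n : ℕ} (p : n.Partition) : YoungDiagram :=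
  YoungDiagram.ofRowLens (p.parts.sort (· ≥ ·)) (p.parts.pairwise_sort (· ≥ ·)).sortedGE

/-! ### Alphabets -/

namespace Alphabet

/-- The inclusion of power series in `X` into power series in `X = {x_i}` and `Y = {y_j}`;
here `x_i` is the variable `Sum.inl i` and `y_j` is the variable `Sum.inr j`. -/
def inX (f : MvPowerSeries ℕ ℂ) : MvPowerSeries (ℕ ⊕ ℕ) ℂ :=
  MvPowerSeries.rename (Function.Embedding.inl : ℕ ↪ ℕ ⊕ ℕ) f

/-- The inclusion of power series in `Y` into power series in `X = {x_i}` and `Y = {y_j}`. -/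
def inY (f : MvPowerSeries ℕ ℂ) : MvPowerSeries (ℕ ⊕ ℕ) ℂ :=
  MvPowerSeries.rename (Function.Embedding.inr : ℕ ↪ ℕ ⊕ ℕ) f

/-- The element `x_i y_j` of the product alphabet `XY`. -/
def prodVar (p : ℕ × ℕ) : MvPowerSeries (ℕ ⊕ ℕ) ℂ :=
  MvPowerSeries.X (Sum.inl p.1) * MvPowerSeries.X (Sum.inr p.2)

theorem hasSubst_prodVar : MvPowerSeries.HasSubst prodVar where
  const_coeff p := by simp [prodVar]
  coeff_zero d := by
    classical
    refine ((d.support ×ˢ d.support).finite_toSet.preimage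
      (f := fun p : ℕ × ℕ => ((Sum.inl p.1 : ℕ ⊕ ℕ), (Sum.inr p.2 : ℕ ⊕ ℕ))) ?_).subset ?_
    · rintro ⟨a, b⟩ - ⟨a', b'⟩ - h
      simpa using h
    · rintro ⟨a, b⟩ h
      simp only [Set.mem_ofPred_eq, prodVar, MvPowerSeries.X, MvPowerSeries.monomial_mul_monomial,
        MvPowerSeries.coeff_monomial, ne_eq, ite_eq_right_iff, not_forall] at h
      obtain ⟨rfl, -⟩ := h
      simp

/-- The evaluation `f(XY)`, at the product alphabet `XY = {x_i y_j}`, of a power series `f` in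
variables indexed by the pairs `(i, j)`. -/
def atXY (f : MvPowerSeries (ℕ × ℕ) ℂ) : MvPowerSeries (ℕ ⊕ ℕ) ℂ :=
  MvPowerSeries.subst prodVar f

end Alphabet

end

/-! Both sides are compared at a monomial `x ^ α y ^ β`. The series `q_n` have the generating
function `∏ (1 - t z u) / (1 - z u)`, and each factor is `1 + (1 - t) ∑_{k ≥ 1} (z u) ^ k`. So a
monomial of degree `n` in `k` distinct variables has coefficient `(1 - t) ^ k` in `q_n`
(`coeff_q_natCast`).

A monomial in the `z_ij` is a matrix of exponents. Substituting `z_ij = x_i y_j` turns it into `x ^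
(row sums) y ^ (column sums)`, and the weight `(1 - t) ^ (number of nonzero entries)` is
multiplicative over the rows. Hence, for `|α| = n`, the coefficient of `x ^ α` in `q_n(XY;t)` is
`∏_k q_{α_k}(Y;t)` (`coeff_atXY_q`).

The coefficient of `x ^ α` in `s_μ` is the Kostka number `K_{μα}`, so what remains is `∏_k q_{α_k} =
∑_μ K_{μα} S_μ`. This is formal: it holds for every sequence `a` in a commutative ring with `a_0 =
1` and `a_s = 0` for `s < 0` (`prod_eq_sum_kostka_mul_jacobiTrudi`). By the Pieri rule each factor
adds a horizontal strip, and a tableau is a chain of such strips, one for each entry.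

The Pieri rule comes from one determinant, in the tails `T s = ∑_{k ≥ s} a_k`, evaluated by column
differences (`det_tail`) and by row differences (`tail_mul_jacobiTrudi`). This multiplies by all
`a_r` at once; a grading variable then isolates a single `r`. -/

/-! ### Jacobi–Trudi determinants -/

section JacobiTrudi

variable {R : Type*} [CommRing R]

/-- The determinant `det (a_{m_i - i + j})` attached to a sequence `a` and row lengths `m`. -/
def jacobiTrudi (a : ℤ → R) {N : ℕ} (m : Fin N → ℕ) : R :=
  Matrix.det (Matrix.of fun i j : Fin N => a ((m i : ℤ) - (i : ℤ) + (j : ℤ)))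

/-- The last row of the matrix is `(0, …, 0, 1)`. -/
theorem jacobiTrudi_succ_of_last_eq_zero {a : ℤ → R} (h0 : a 0 = 1) (hneg : ∀ s < 0, a s = 0)
    {N : ℕ} (m : Fin (N + 1) → ℕ) (hm : m (Fin.last N) = 0) :
    jacobiTrudi a m = jacobiTrudi a fun i : Fin N => m i.castSucc := by
  rw [jacobiTrudi, Matrix.det_succ_row _ (Fin.last N), Fin.sum_univ_castSucc,
    Finset.sum_eq_zero, zero_add]
  · simp only [Fin.val_last, Matrix.of_apply, hm, Nat.cast_zero, zero_sub, neg_add_cancel, h0,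
      ← two_mul, pow_mul, neg_one_sq, one_pow, one_mul, Fin.succAbove_last]
    rfl
  · intro j _
    rw [Matrix.of_apply, hm, hneg _ (by simp), mul_zero, zero_mul]

theorem jacobiTrudi_congr {a b : ℤ → R} {N : ℕ} (m : Fin N → ℕ)
    (h : ∀ i, ∀ s ≤ (m i : ℤ) + N, a s = b s) : jacobiTrudi a m = jacobiTrudi b m := by
  unfold jacobiTrudi
  congr 2
  ext i j
  exact h i _ (by have := j.2; omega)

theorem jacobiTrudi_map {S : Type*} [CommRing S] (φ : R →+* S) (a : ℤ → R) {N : ℕ}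
    (m : Fin N → ℕ) : jacobiTrudi (fun s => φ (a s)) m = φ (jacobiTrudi a m) := by
  rw [jacobiTrudi, jacobiTrudi, RingHom.map_det]
  rfl

open Polynomial in
-- If `a_s` has degree `s`, the determinant is homogeneous of degree `∑ m_i`: multiplying row `i` by
-- `X ^ i` gives the entry in column `j` the power `X ^ (m_i + j)`, which splits into a row factor
-- and a column factor. The extra `X ^ ∑ i` is cancelled at the end.
theorem jacobiTrudi_homogenize {a : ℤ → R} (hneg : ∀ s < 0, a s = 0) {N : ℕ} (m : Fin N → ℕ) :
    jacobiTrudi (fun s => C (a s) * X ^ s.toNat) m = C (jacobiTrudi a m) * X ^ ∑ i, m i := by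
  have hX : IsRegular ((X : R[X]) ^ ∑ i : Fin N, (i : ℕ)) :=
    (monic_X.pow _).isRegular
  apply hX.left
  dsimp only
  rw [← jacobiTrudi_map, ← Finset.prod_pow_eq_pow_sum, ← Finset.prod_pow_eq_pow_sum,
    jacobiTrudi, ← Matrix.det_mul_column, mul_comm _ (∏ i, X ^ m i), jacobiTrudi,
    ← Matrix.det_mul_column, ← Matrix.det_mul_row]
  congr 1
  ext i j : 1
  simp only [Matrix.of_apply]
  rcases lt_or_ge ((m i : ℤ) - (i : ℤ) + (j : ℤ)) 0 with h | h
  · simp [hneg _ h]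
  · have h' : (i : ℕ) + ((m i : ℤ) - (i : ℤ) + (j : ℤ)).toNat = m i + j := by omega
    rw [mul_left_comm, ← pow_add, h', pow_add]
    ring

/-- Subtracting from each column its predecessor leaves `-a` in every column but the first. In the
last row, where `m = 0`, those entries have negative index, so only `T (-N) = T 0` survives. The
sign of the cofactor cancels the `N` signs of the minor. -/
theorem det_tail {a T : ℤ → R} (hneg : ∀ s < 0, a s = 0) (hT : ∀ s, T s = a s + T (s + 1))
    {N : ℕ} (m : Fin (N + 1) → ℕ) (hm : m (Fin.last N) = 0) :
    Matrix.det (Matrix.of fun i j : Fin (N + 1) => T ((m i : ℤ) - (i : ℤ) + (j : ℤ)))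
      = T 0 * jacobiTrudi a fun i : Fin N => m i.castSucc := by
  have hT0 : ∀ k : ℕ, T (-k) = T 0 := by
    intro k
    induction k with
    | zero => simp
    | succ k ih => rw [hT, hneg _ (by omega), zero_add, ← ih]; congr 1; push_cast; ring
  let B : Matrix (Fin (N + 1)) (Fin (N + 1)) R := Matrix.of fun i =>
    Fin.cons (T ((m i : ℤ) - i)) fun j : Fin N => - a ((m i : ℤ) - (i : ℤ) + (j : ℤ))
  rw [Matrix.det_eq_of_forall_col_eq_smul_add_pred (B := B) (fun _ => 1)]
  · rw [Matrix.det_succ_row _ (Fin.last N), Fin.sum_univ_succ, Finset.sum_eq_zero, add_zero]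
    · have h : B.submatrix (Fin.last N).succAbove (Fin.succAbove 0)
          = - Matrix.of fun i j : Fin N => a ((m i.castSucc : ℤ) - (i : ℤ) + (j : ℤ)) := by
        ext i j
        simp [B]
      rw [h, Matrix.det_neg, jacobiTrudi]
      simp only [B, Matrix.of_apply, Fin.cons_zero, hm, Fin.val_last, Nat.cast_zero, zero_sub, hT0,
        Fintype.card_fin, Fin.val_zero, add_zero]
      have := Even.neg_one_pow (α := R) (Even.add_self N)
      rw [pow_add] at this
      linear_combination (T 0 * Matrix.det (Matrix.of fun i j : Fin N =>
        a ((m i.castSucc : ℤ) - (i : ℤ) + (j : ℤ)))) * this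
    · intro j _
      simp only [B, Matrix.of_apply, Fin.cons_succ, hm]
      rw [hneg _ (by simp)]
      simp
  · intro i
    simp [B]
  · intro i j
    simp only [B, Matrix.of_apply, Fin.cons_succ, Fin.val_succ, Fin.val_castSucc]
    rw [hT ((m i : ℤ) - i + (j : ℕ))]
    push_cast
    ring_nf

theorem sum_Ico_eq_tail_sub {a T : ℤ → R} (hT : ∀ s, T s = a s + T (s + 1)) {p q : ℕ}
    (h : p ≤ q) (c : ℤ) : ∑ k ∈ Finset.Ico p q, a (k + c) = T (p + c) - T (q + c) := by
  induction q, h using Nat.le_induction with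
  | base => simp
  | succ q h ih =>
    rw [Finset.sum_Ico_succ_top h, ih, hT (q + c)]
    push_cast
    ring_nf

/-- The range of the `i`-th row length in a diagram obtained from one with row lengths `m` by adding
a horizontal strip, where the length of the first row is less than `M`. -/
def stripInterval (M : ℕ) {N : ℕ} (m : Fin (N + 1) → ℕ) : Fin (N + 1) → Finset ℕ :=
  Fin.cons (Finset.Ico (m 0) M) fun i : Fin N => Finset.Ico (m i.succ) (m i.castSucc + 1)

/-- In the determinant of `det_tail`, subtracting from each row its predecessor turns the tails into
finite sums of `a (k - i + j)`, with `k` running over exactly the row lengths a horizontal strip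
allows. Multilinearity in the rows then expands the determinant. The first row has no predecessor,
so its sum stops only where `T` vanishes, at `M`. -/
theorem tail_mul_jacobiTrudi {a T : ℤ → R} (hneg : ∀ s < 0, a s = 0)
    (hT : ∀ s, T s = a s + T (s + 1)) {M : ℕ} (hM : ∀ s, (M : ℤ) ≤ s → T s = 0)
    {N : ℕ} (m : Fin (N + 1) → ℕ) (hanti : Antitone m) (hm : m (Fin.last N) = 0) (h0 : m 0 ≤ M) :
    T 0 * jacobiTrudi a (fun i : Fin N => m i.castSucc)
      = ∑ f ∈ Fintype.piFinset (stripInterval M m), jacobiTrudi a f := by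
  rw [← det_tail hneg hT m hm]
  let B : Matrix (Fin (N + 1)) (Fin (N + 1)) R := fun i =>
    ∑ k ∈ stripInterval M m i, fun j : Fin (N + 1) => a ((k : ℤ) - (i : ℤ) + (j : ℤ))
  rw [Matrix.det_eq_of_forall_row_eq_smul_add_pred (B := B) (fun _ => 1)]
  · exact MultilinearMap.map_sum_finset (Matrix.detRowAlternating (R := R)).toMultilinearMap
      (fun (i : Fin (N + 1)) (k : ℕ) (j : Fin (N + 1)) => a ((k : ℤ) - (i : ℤ) + (j : ℤ))) _
  · intro j
    simp only [B, Matrix.of_apply, Finset.sum_apply, stripInterval, Fin.cons_zero, sub_add_eq_add_sub,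
      add_sub_assoc]
    rw [sum_Ico_eq_tail_sub hT h0, hM (M + _) (by simp), sub_zero]
  · intro i j
    simp only [B, Matrix.of_apply, Finset.sum_apply, stripInterval, Fin.cons_succ,
      sub_add_eq_add_sub, add_sub_assoc]
    rw [sum_Ico_eq_tail_sub hT ((hanti (Fin.castSucc_lt_succ (i := i)).le).trans (Nat.le_succ _))]
    simp only [Fin.val_succ, Fin.val_castSucc]
    push_cast
    ring_nf

open Polynomial in
/-- The Pieri rule, for sequences of row lengths. -/
theorem mul_jacobiTrudi {a : ℤ → R} (hneg : ∀ s < 0, a s = 0) {N : ℕ} (m : Fin (N + 1) → ℕ)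
    (hanti : Antitone m) (hm : m (Fin.last N) = 0) (r : ℕ) {M : ℕ}
    (hM : ∑ i, m i + r + N + 2 ≤ M) :
    a r * jacobiTrudi a (fun i : Fin N => m i.castSucc)
      = ∑ f ∈ Fintype.piFinset (stripInterval M m) with ∑ i, f i = ∑ i, m i + r,
          jacobiTrudi a f := by
  classical
  have hle : ∀ (f : Fin (N + 1) → ℕ) i, f i ≤ ∑ i, f i := fun f i =>
    Finset.single_le_sum (fun _ _ => Nat.zero_le _) (Finset.mem_univ i)
  -- Truncation at `M` makes the tails finite sums; `M` is large enough that no determinant in the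
  -- statement sees the difference.
  let b : ℤ → R := fun s => if s < M then a s else 0
  have hbneg : ∀ s < 0, b s = 0 := fun s hs => by
    simp only [b]
    rw [hneg s hs, ite_self]
  let c : ℤ → R[X] := fun s => C (b s) * X ^ s.toNat
  let T : ℤ → R[X] := fun s => ∑ k ∈ Finset.Ico s M, c k
  have hcneg : ∀ s < 0, c s = 0 := fun s hs => by simp [c, hbneg s hs]
  have hTM : ∀ s, (M : ℤ) ≤ s → T s = 0 := fun s hs => by simp [T, hs]
  have hT : ∀ s, T s = c s + T (s + 1) := by
    intro s
    rcases lt_or_ge s M with h | h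
    · simp only [T]
      rw [← Finset.insert_Ico_add_one_left_eq_Ico h, Finset.sum_insert (by simp)]
    · rw [hTM s h, hTM (s + 1) (by omega)]
      simp [c, b, h.not_gt]
  have key := tail_mul_jacobiTrudi hcneg hT hTM m hanti hm (by have := hle m 0; omega)
  -- In this degree the left side keeps only the term `a r` of `T 0`, and the right side only the
  -- strips with `r` cells.
  have key' := congrArg (fun p : R[X] => p.coeff (∑ i, m i + r)) key
  have hsum : ∑ i : Fin N, m i.castSucc = ∑ i, m i := by
    rw [Fin.sum_univ_castSucc, hm, add_zero]
  simp only [c, jacobiTrudi_homogenize hbneg, finsetSum_coeff, hsum] at key'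
  rw [← mul_assoc, add_comm (∑ i, m i) r, coeff_mul_X_pow, coeff_mul_C] at key'
  have hTr : (T 0).coeff r = a r := by
    simp only [T, c, finsetSum_coeff, coeff_C_mul, coeff_X_pow]
    rw [Finset.sum_eq_single (r : ℤ)]
    · simp only [b, Int.toNat_natCast, if_true, mul_one]
      rw [if_pos (by omega)]
    · intro k hk hkr
      rw [Finset.mem_Ico] at hk
      rw [if_neg (by omega), mul_zero]
    · intro h
      exact absurd (Finset.mem_Ico.2 ⟨by omega, by omega⟩) h
  rw [hTr] at key'
  rw [Finset.sum_filter]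
  have hb : ∀ {K : ℕ} (f : Fin K → ℕ), (∀ i, f i + K < M) → jacobiTrudi b f = jacobiTrudi a f := by
    intro K f hf
    refine jacobiTrudi_congr f fun i s hs => ?_
    simp only [b]
    rw [if_pos (by have := hf i; omega)]
  rw [hb (fun i : Fin N => m i.castSucc) fun i => by have := hle m i.castSucc; omega] at key'
  rw [key']
  refine Finset.sum_congr rfl fun f _ => ?_
  rw [coeff_C_mul, coeff_X_pow]
  split_ifs with h1 h2 h2
  · rw [mul_one, hb]
    intro i
    have := hle f i
    omega
  · omega
  · omega
  · simp

end JacobiTrudi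

/-! ### Young diagrams, horizontal strips and the Pieri rule -/

noncomputable section

namespace YoungDiagram

theorem ext_rowLen {μ ν : YoungDiagram} (h : ∀ i, μ.rowLen i = ν.rowLen i) : μ = ν := by
  ext ⟨i, j⟩
  rw [mem_cells, mem_cells, mem_iff_lt_rowLen, mem_iff_lt_rowLen, h]

theorem rowLen_eq_zero_iff {μ : YoungDiagram} {i : ℕ} : μ.rowLen i = 0 ↔ μ.colLen 0 ≤ i := by
  rw [← not_lt, ← mem_iff_lt_colLen, mem_iff_lt_rowLen, not_lt, Nat.le_zero]

theorem card_eq_sum_rowLen (μ : YoungDiagram) {N : ℕ} (hN : μ.colLen 0 ≤ N) :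
    μ.card = ∑ i ∈ Finset.range N, μ.rowLen i := by
  rw [YoungDiagram.card, Finset.card_eq_sum_card_fiberwise (f := Prod.fst) (t := Finset.range N)]
  · exact Finset.sum_congr rfl fun i _ => (rowLen_eq_card μ).symm
  · rintro ⟨i, j⟩ h
    rw [Finset.mem_coe, mem_cells] at h
    have : i < μ.colLen 0 := mem_iff_lt_colLen.1 (μ.up_left_mem le_rfl (Nat.zero_le j) h)
    simpa using this.trans_le hN

theorem sum_rowLens (μ : YoungDiagram) : μ.rowLens.sum = μ.card := by
  rw [μ.card_eq_sum_rowLen le_rfl]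
  rfl

/-- The Young diagram whose row lengths are the values of an antitone function on `Fin N`. -/
def ofAntitone {N : ℕ} (f : Fin N → ℕ) (hf : Antitone f) : YoungDiagram where
  cells := Finset.univ.biUnion fun i : Fin N => {(i : ℕ)} ×ˢ Finset.range (f i)
  isLowerSet := by
    rintro ⟨i, j⟩ ⟨i', j'⟩ ⟨hi, hj⟩ h
    simp only [Finset.coe_biUnion, Set.mem_iUnion, Finset.mem_coe, Finset.mem_product,
      Finset.mem_singleton, Finset.mem_range, Finset.mem_univ, exists_true_left] at h ⊢ hi hj
    obtain ⟨k, rfl, hk⟩ := h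
    have hik : i' < N := hi.trans_lt k.2
    exact ⟨⟨i', hik⟩, rfl, hj.trans_lt (hk.trans_le (hf hi))⟩

theorem mem_ofAntitone {N : ℕ} {f : Fin N → ℕ} {hf : Antitone f} {i j : ℕ} :
    (i, j) ∈ ofAntitone f hf ↔ ∃ h : i < N, j < f ⟨i, h⟩ := by
  rw [← mem_cells]
  simp only [ofAntitone, Finset.mem_biUnion, Finset.mem_product, Finset.mem_singleton,
    Finset.mem_range, Finset.mem_univ, true_and]
  constructor
  · rintro ⟨k, rfl, hk⟩
    exact ⟨k.2, hk⟩
  · rintro ⟨h, hj⟩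
    exact ⟨⟨i, h⟩, rfl, hj⟩

theorem rowLen_ofAntitone {N : ℕ} {f : Fin N → ℕ} {hf : Antitone f} (i : Fin N) :
    (ofAntitone f hf).rowLen i = f i := by
  refine eq_of_forall_lt_iff fun j => ?_
  rw [← mem_iff_lt_rowLen, mem_ofAntitone]
  simp

theorem colLen_ofAntitone_le {N : ℕ} {f : Fin N → ℕ} {hf : Antitone f} :
    (ofAntitone f hf).colLen 0 ≤ N := by
  rw [← not_lt, ← mem_iff_lt_colLen, mem_ofAntitone]
  simp

open scoped Classical in
/-- The finite set of Young diagrams with `n` cells. -/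
def withCard (n : ℕ) : Finset YoungDiagram :=
  Finset.univ.image (Nat.Partition.youngDiagram (n := n))

theorem rowLens_partition {n : ℕ} (p : n.Partition) :
    p.youngDiagram.rowLens = p.parts.sort (· ≥ ·) :=
  rowLens_ofRowLens_eq_self fun _ hx => p.parts_pos ((Multiset.mem_sort _).1 hx)

theorem partition_injective (n : ℕ) :
    Function.Injective (Nat.Partition.youngDiagram (n := n)) := by
  intro p p' h
  have h' := congrArg rowLens h
  rw [rowLens_partition, rowLens_partition] at h'
  refine Nat.Partition.ext ?_
  rw [← Multiset.sort_eq p.parts (· ≥ ·), h', Multiset.sort_eq]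

theorem mem_withCard {n : ℕ} {μ : YoungDiagram} : μ ∈ withCard n ↔ μ.card = n := by
  simp only [withCard, Finset.mem_image, Finset.mem_univ, true_and]
  constructor
  · rintro ⟨p, rfl⟩
    rw [← sum_rowLens, rowLens_partition, ← Multiset.sum_coe, Multiset.sort_eq, p.parts_sum]
  · intro h
    refine ⟨⟨(μ.rowLens : Multiset ℕ), fun hi => μ.pos_of_mem_rowLens _ hi, ?_⟩, ?_⟩
    · rw [Multiset.sum_coe, sum_rowLens, h]
    · apply equivListRowLens.injective
      apply Subtype.ext
      change rowLens _ = rowLens _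
      rw [rowLens_partition, Multiset.coe_sort]
      exact List.mergeSort_eq_self _ (by simpa using μ.rowLens_sorted.pairwise)

theorem sum_partition {M : Type*} [AddCommMonoid M] (n : ℕ) (f : YoungDiagram → M) :
    ∑ p : n.Partition, f p.youngDiagram = ∑ μ ∈ withCard n, f μ := by
  classical
  rw [withCard, Finset.sum_image fun p _ p' _ h => partition_injective n h]

/-- `μ / ν` is a horizontal strip: `ν ≤ μ` and `μ / ν` has at most one cell in each column. -/
def IsHorizontalStrip (ν μ : YoungDiagram) : Prop :=
  ν ≤ μ ∧ ∀ i j, (i + 1, j) ∈ μ → (i, j) ∈ ν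

theorem isHorizontalStrip_iff {ν μ : YoungDiagram} : IsHorizontalStrip ν μ ↔
    ∀ i, ν.rowLen i ≤ μ.rowLen i ∧ μ.rowLen (i + 1) ≤ ν.rowLen i := by
  rw [forall_and]
  refine and_congr ⟨fun h i => ?_, fun h => ?_⟩ (forall_congr' fun i => ?_)
  · refine le_of_forall_lt fun j hj => ?_
    rw [← mem_iff_lt_rowLen] at hj ⊢
    exact h hj
  · rintro ⟨i, j⟩ hj
    rw [mem_iff_lt_rowLen] at hj ⊢
    exact hj.trans_le (h i)
  · simp only [mem_iff_lt_rowLen]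
    exact ⟨le_of_forall_lt, fun h j hj => hj.trans_le h⟩

section

variable {R : Type*} [CommRing R]

/-- The Jacobi–Trudi determinant of a Young diagram, for a sequence `a`. -/
def jacobiTrudi (a : ℤ → R) (μ : YoungDiagram) : R :=
  _root_.jacobiTrudi a fun i : Fin (μ.colLen 0) => μ.rowLen i

/-- Padding by empty rows is needed because the Pieri rule yields determinants of size `N + 1`
whether or not the strip opens a new row. -/
theorem jacobiTrudi_eq_of_colLen_le {a : ℤ → R} (h0 : a 0 = 1) (hneg : ∀ s < 0, a s = 0)
    (μ : YoungDiagram) {N : ℕ} (hN : μ.colLen 0 ≤ N) :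
    μ.jacobiTrudi a = _root_.jacobiTrudi a fun i : Fin N => μ.rowLen i := by
  induction N, hN using Nat.le_induction with
  | base => rfl
  | succ N h ih =>
    rw [ih, jacobiTrudi_succ_of_last_eq_zero h0 hneg _ (rowLen_eq_zero_iff.2 h)]
    rfl

open scoped Classical in
/-- The Pieri rule for Jacobi–Trudi determinants. -/
theorem mul_jacobiTrudi {a : ℤ → R} (h0 : a 0 = 1) (hneg : ∀ s < 0, a s = 0)
    (ν : YoungDiagram) (r : ℕ) :
    a r * ν.jacobiTrudi a
      = ∑ μ ∈ withCard (ν.card + r) with IsHorizontalStrip ν μ, μ.jacobiTrudi a := by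
  set N := ν.colLen 0 with hN
  let m : Fin (N + 1) → ℕ := fun i => ν.rowLen i
  have hm : m (Fin.last N) = 0 := rowLen_eq_zero_iff.2 le_rfl
  have hanti : Antitone m := fun i j h => ν.rowLen_anti _ _ h
  have hsum : ∑ i, m i = ν.card := by
    rw [ν.card_eq_sum_rowLen (Nat.le_succ N), Finset.sum_range]
  have key := _root_.mul_jacobiTrudi hneg m hanti hm r le_rfl
  rw [hsum] at key
  refine key.trans (Eq.symm ?_)
  have hcol : ∀ {μ : YoungDiagram}, IsHorizontalStrip ν μ → μ.colLen 0 ≤ N + 1 := fun h => by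
    rw [← rowLen_eq_zero_iff, ← Nat.le_zero]
    exact ((isHorizontalStrip_iff.1 h N).2).trans_eq hm
  have hcard : ∀ {μ : YoungDiagram}, IsHorizontalStrip ν μ →
      ∑ i : Fin (N + 1), μ.rowLen i = μ.card := fun h => by
    rw [card_eq_sum_rowLen _ (hcol h), Finset.sum_range]
  -- A horizontal strip adds at most one row, so `μ` is determined by its first `N + 1` row lengths.
  refine Finset.sum_nbij (fun μ i => μ.rowLen i) ?_ ?_ ?_ ?_
  · intro μ hμ
    rw [Finset.mem_filter, mem_withCard] at hμ
    rw [Finset.mem_filter, Fintype.mem_piFinset]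
    have hs := isHorizontalStrip_iff.1 hμ.2
    refine ⟨Fin.cases ?_ fun i => ?_, by rw [hcard hμ.2, hμ.1]⟩
    · simp only [stripInterval, Fin.cons_zero, Finset.mem_Ico]
      refine ⟨(hs 0).1, ?_⟩
      have : μ.rowLen (0 : Fin (N + 1)) ≤ ∑ i : Fin (N + 1), μ.rowLen i :=
        Finset.single_le_sum (f := fun i : Fin (N + 1) => μ.rowLen i) (fun _ _ => Nat.zero_le _)
          (Finset.mem_univ 0)
      rw [hcard hμ.2] at this
      omega
    · simp only [stripInterval, Fin.cons_succ, Finset.mem_Ico, Nat.lt_succ_iff]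
      exact ⟨(hs (i + 1)).1, (hs i).2⟩
  · intro μ hμ μ' hμ' h
    rw [Finset.mem_coe, Finset.mem_filter] at hμ hμ'
    refine ext_rowLen fun i => ?_
    rcases lt_or_ge i (N + 1) with hi | hi
    · exact congrFun h ⟨i, hi⟩
    · rw [rowLen_eq_zero_iff.2 ((hcol hμ.2).trans hi), rowLen_eq_zero_iff.2 ((hcol hμ'.2).trans hi)]
  · intro f hf
    rw [Finset.mem_coe, Finset.mem_filter, Fintype.mem_piFinset] at hf
    obtain ⟨hf, hfs⟩ := hf
    have hf1 : ∀ i : Fin N, m i.succ ≤ f i.succ ∧ f i.succ ≤ m i.castSucc := fun i => by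
      have := hf i.succ
      rwa [stripInterval, Fin.cons_succ, Finset.mem_Ico, Nat.lt_succ_iff] at this
    have hf0 : m 0 ≤ f 0 := by
      have := hf 0
      rw [stripInterval, Fin.cons_zero, Finset.mem_Ico] at this
      exact this.1
    have hmf : ∀ i, m i ≤ f i := Fin.cases hf0 fun i => (hf1 i).1
    have hfa : Antitone f := Fin.antitone_iff_succ_le.2 fun i => (hf1 i).2.trans (hmf _)
    have hstrip : IsHorizontalStrip ν (ofAntitone f hfa) := by
      refine isHorizontalStrip_iff.2 fun i => ⟨?_, ?_⟩
      · rcases lt_or_ge i (N + 1) with hi | hi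
        · exact (hmf ⟨i, hi⟩).trans_eq (rowLen_ofAntitone ⟨i, hi⟩).symm
        · rw [rowLen_eq_zero_iff.2 ((Nat.le_succ N).trans hi)]
          exact Nat.zero_le _
      · rcases lt_or_ge i N with hi | hi
        · exact (rowLen_ofAntitone (Fin.succ ⟨i, hi⟩)).trans_le (hf1 ⟨i, hi⟩).2
        · rw [rowLen_eq_zero_iff.2 (colLen_ofAntitone_le.trans (Nat.succ_le_succ hi))]
          exact Nat.zero_le _
    have hrow : (fun i : Fin (N + 1) => (ofAntitone f hfa).rowLen i) = f :=
      funext rowLen_ofAntitone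
    refine ⟨ofAntitone f hfa, ?_, hrow⟩
    rw [Finset.mem_coe, Finset.mem_filter, mem_withCard]
    refine ⟨?_, hstrip⟩
    rw [← hcard hstrip, ← hfs]
    exact congrArg (fun g : Fin (N + 1) → ℕ => ∑ i, g i) hrow
  · intro μ hμ
    rw [Finset.mem_filter] at hμ
    exact jacobiTrudi_eq_of_colLen_le h0 hneg μ (hcol hμ.2)

end

end YoungDiagram

end

/-! ### Semistandard tableaux and Kostka numbers -/

noncomputable section

namespace SemistandardYoungTableau

open YoungDiagram

variable {μ ν : YoungDiagram}

theorem degree_content (T : SemistandardYoungTableau μ) : T.content.degree = μ.card := by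
  simp [content, map_sum]

theorem apply_mem_support_content (T : SemistandardYoungTableau μ) {i j : ℕ} (h : (i, j) ∈ μ) :
    T i j ∈ T.content.support := by
  rw [Finsupp.mem_support_iff, content, Finsupp.finsetSum_apply]
  refine (Finset.sum_pos' (fun _ _ => Nat.zero_le _) ⟨(i, j), (mem_cells _).2 h, ?_⟩).ne'
  simp

theorem content_eq_add_single (T : SemistandardYoungTableau μ) (T' : SemistandardYoungTableau ν)
    (hνμ : ν ≤ μ) {N : ℕ} (hT : ∀ i j, (i, j) ∈ ν → T i j = T' i j)
    (hN : ∀ i j, (i, j) ∈ μ → (i, j) ∉ ν → T i j = N) :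
    T.content = T'.content + Finsupp.single N (μ.cells \ ν.cells).card := by
  rw [content, ← Finset.sum_sdiff (cells_subset_iff.2 hνμ), add_comm, content]
  congr 1
  · exact Finset.sum_congr rfl fun c hc => by rw [hT _ _ ((mem_cells _).1 hc)]
  · rw [Finset.sum_congr rfl (g := fun _ => Finsupp.single N 1)]
    · simp
    · intro c hc
      rw [Finset.mem_sdiff, mem_cells, mem_cells] at hc
      rw [hN _ _ hc.1 hc.2]

/-- The diagram formed by the cells with entries less than `N`. -/
def below (T : SemistandardYoungTableau μ) (N : ℕ) : YoungDiagram where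
  cells := {c ∈ μ.cells | T c.1 c.2 < N}
  isLowerSet := by
    rintro ⟨i, j⟩ ⟨i', j'⟩ ⟨hi, hj⟩ h
    simp only [Finset.coe_filter, Set.mem_ofPred_eq, mem_cells] at h ⊢ hi hj
    exact ⟨μ.up_left_mem hi hj h.1, ((T.row_weak_of_le hj
      (μ.up_left_mem hi le_rfl h.1)).trans (T.col_weak hi h.1)).trans_lt h.2⟩

theorem mem_below {T : SemistandardYoungTableau μ} {N i j : ℕ} :
    (i, j) ∈ T.below N ↔ (i, j) ∈ μ ∧ T i j < N := by
  rw [← mem_cells, below]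
  simp

/-- The restriction of a tableau to a smaller diagram. -/
def restrict (T : SemistandardYoungTableau μ) (hνμ : ν ≤ μ) : SemistandardYoungTableau ν where
  entry i j := if (i, j) ∈ ν then T i j else 0
  row_weak' {i j1 j2} hj h := by
    rw [if_pos h, if_pos (ν.up_left_mem le_rfl hj.le h)]
    exact T.row_weak hj (hνμ h)
  col_strict' {i1 i2 j} hi h := by
    rw [if_pos h, if_pos (ν.up_left_mem hi.le le_rfl h)]
    exact T.col_strict hi (hνμ h)
  zeros' h := if_neg h

theorem restrict_apply (T : SemistandardYoungTableau μ) (hνμ : ν ≤ μ) {i j : ℕ}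
    (h : (i, j) ∈ ν) : T.restrict hνμ i j = T i j :=
  if_pos h

/-- The extension of a tableau by entries `N` along a horizontal strip. -/
def extend (T : SemistandardYoungTableau ν) (hs : IsHorizontalStrip ν μ) {N : ℕ}
    (hN : ∀ i j, (i, j) ∈ ν → T i j < N) : SemistandardYoungTableau μ where
  entry i j := if (i, j) ∈ ν then T i j else if (i, j) ∈ μ then N else 0
  row_weak' {i j1 j2} hj h := by
    by_cases h2 : (i, j2) ∈ ν
    · rw [if_pos h2, if_pos (ν.up_left_mem le_rfl hj.le h2)]
      exact T.row_weak hj h2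
    · rw [if_neg h2, if_pos h, if_pos (μ.up_left_mem le_rfl hj.le h)]
      split_ifs with h1
      exacts [(hN _ _ h1).le, le_rfl]
  col_strict' {i1 i2 j} hi h := by
    have h1 : (i1, j) ∈ ν := hs.2 _ _ (μ.up_left_mem hi le_rfl h)
    rw [if_pos h1, if_pos h]
    split_ifs with h2
    exacts [T.col_strict hi h2, hN _ _ h1]
  zeros' h := by rw [if_neg fun h' => h (hs.1 h'), if_neg h]

theorem extend_apply_of_mem (T : SemistandardYoungTableau ν) (hs : IsHorizontalStrip ν μ) {N : ℕ}
    (hN : ∀ i j, (i, j) ∈ ν → T i j < N) {i j : ℕ} (h : (i, j) ∈ ν) :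
    T.extend hs hN i j = T i j :=
  if_pos h

theorem extend_apply_of_notMem (T : SemistandardYoungTableau ν) (hs : IsHorizontalStrip ν μ)
    {N : ℕ} (hN : ∀ i j, (i, j) ∈ ν → T i j < N) {i j : ℕ} (h : (i, j) ∈ μ) (h' : (i, j) ∉ ν) :
    T.extend hs hN i j = N := by
  change (if (i, j) ∈ ν then T i j else if (i, j) ∈ μ then N else 0) = N
  rw [if_neg h', if_pos h]

/-- The Kostka number: the number of tableaux of given shape and content. -/
def kostka (μ : YoungDiagram) (α : ℕ →₀ ℕ) : ℕ :=
  {T : SemistandardYoungTableau μ | T.content = α}.ncard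

theorem lt_of_support_subset {T : SemistandardYoungTableau μ} {N : ℕ}
    (h : T.content.support ⊆ Finset.range N) (i j : ℕ) (hc : (i, j) ∈ μ) : T i j < N :=
  Finset.mem_range.1 (h (T.apply_mem_support_content hc))

/-- Entries increase strictly down columns and are at most `N`, so every cell that has a cell below
it carries an entry less than `N`. -/
theorem isHorizontalStrip_below {T : SemistandardYoungTableau μ} {N : ℕ}
    (h : T.content.support ⊆ Finset.range (N + 1)) : IsHorizontalStrip (T.below N) μ :=
  ⟨fun _ hc => (mem_below.1 hc).1, fun i _ hc => mem_below.2
    ⟨μ.up_left_mem (Nat.le_succ i) le_rfl hc,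
      (T.col_strict (Nat.lt_succ_self i) hc).trans_le
        (Nat.lt_succ_iff.1 (lt_of_support_subset h _ _ hc))⟩⟩

theorem content_restrict {T : SemistandardYoungTableau μ} {N : ℕ}
    (h : T.content.support ⊆ Finset.range (N + 1)) (hνμ : ν ≤ μ) (hν : T.below N = ν) :
    (T.restrict hνμ).content = T.content.erase N := by
  subst hν
  have key := content_eq_add_single T (T.restrict hνμ) hνμ (N := N)
    (fun i j hc => (T.restrict_apply hνμ hc).symm) fun i j hc hc' => by
      have h1 := lt_of_support_subset h _ _ hc
      rw [mem_below, not_and, not_lt] at hc'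
      have := hc' hc
      omega
  have h0 : N ∉ (T.restrict hνμ).content.support := by
    rw [content]
    intro hN
    obtain ⟨c, hc, hcN⟩ := Finset.mem_biUnion.1 (Finsupp.support_finsetSum hN)
    rw [Finsupp.support_single _ one_ne_zero, Finset.mem_singleton] at hcN
    rw [mem_cells] at hc
    rw [restrict_apply _ _ hc] at hcN
    exact (mem_below.1 hc).2.ne' hcN
  rw [key, Finsupp.erase_add, Finsupp.erase_single, add_zero, Finsupp.erase_of_notMem_support h0]

/-- Restriction to `ν` is inverted by filling `μ / ν` with `N`: cells outside `T.below N` carry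
entries at least `N`, and the content forbids larger ones. The two cardinality hypotheses make the
number of added cells equal to `α N`. -/
theorem ncard_below_eq {α : ℕ →₀ ℕ} {N : ℕ} (h : α.support ⊆ Finset.range (N + 1))
    (hμ : μ.card = α.degree) (hν : ν.card = (α.erase N).degree) (hs : IsHorizontalStrip ν μ) :
    {T : SemistandardYoungTableau μ | T.content = α ∧ T.below N = ν}.ncard
      = kostka ν (α.erase N) := by
  refine Set.ncard_congr (fun T _ => T.restrict hs.1) ?_ ?_ ?_
  · rintro T ⟨rfl, hT⟩
    exact content_restrict h hs.1 hT
  · rintro T T' ⟨rfl, hT⟩ ⟨hc, hT'⟩ hr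
    ext i j
    by_cases hμc : (i, j) ∈ μ
    · by_cases hνc : (i, j) ∈ ν
      · rw [← restrict_apply T hs.1 hνc, hr, restrict_apply T' hs.1 hνc]
      · have h1 := lt_of_support_subset h _ _ hμc
        have h2 := lt_of_support_subset (hc ▸ h) _ _ hμc
        have h3 : (i, j) ∉ T.below N := hT ▸ hνc
        have h4 : (i, j) ∉ T'.below N := hT' ▸ hνc
        rw [mem_below, not_and, not_lt] at h3 h4
        have := h3 hμc
        have := h4 hμc
        omega
    · rw [T.zeros hμc, T'.zeros hμc]
  · intro T hT
    have hT' : T.content = α.erase N := hT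
    have hN : ∀ i j, (i, j) ∈ ν → T i j < N := fun i j hc => by
      have := T.apply_mem_support_content hc
      rw [hT', Finsupp.support_erase, Finset.mem_erase] at this
      have h' := Finset.mem_range.1 (h this.2)
      omega
    have hdeg : α.degree = (α.erase N).degree + α N := by
      conv_lhs => rw [← Finsupp.erase_add_single N α]
      simp
    refine ⟨T.extend hs hN, ⟨?_, ?_⟩, ?_⟩
    · rw [content_eq_add_single (T.extend hs hN) T hs.1 (N := N)
        (fun i j hc => T.extend_apply_of_mem hs hN hc)
        (fun i j hc hc' => T.extend_apply_of_notMem hs hN hc hc'), hT',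
        Finset.card_sdiff_of_subset (cells_subset_iff.2 hs.1)]
      change α.erase N + Finsupp.single N (μ.card - ν.card) = α
      rw [hμ, hν, hdeg, Nat.add_sub_cancel_left, Finsupp.erase_add_single]
    · ext ⟨i, j⟩
      rw [mem_cells, mem_cells, mem_below]
      constructor
      · rintro ⟨hc, hlt⟩
        by_contra hc'
        rw [T.extend_apply_of_notMem hs hN hc hc'] at hlt
        exact lt_irrefl _ hlt
      · intro hc
        refine ⟨hs.1 hc, ?_⟩
        rw [T.extend_apply_of_mem hs hN hc]
        exact hN _ _ hc
    · ext i j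
      by_cases hc : (i, j) ∈ ν
      · rw [restrict_apply _ _ hc, T.extend_apply_of_mem hs hN hc]
      · rw [zeros _ hc, zeros _ hc]

open scoped Classical in
/-- Removing the cells with the largest entry. -/
theorem kostka_eq_sum {α : ℕ →₀ ℕ} {N : ℕ} (h : α.support ⊆ Finset.range (N + 1))
    (hμ : μ.card = α.degree) :
    kostka μ α = ∑ ν ∈ withCard (α.erase N).degree with IsHorizontalStrip ν μ,
      kostka ν (α.erase N) := by
  have hfin := finite_content_eq μ α
  rw [kostka, Set.ncard_eq_toFinset_card _ hfin,
    Finset.card_eq_sum_card_fiberwise (f := fun T => T.below N)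
      (t := {ν ∈ withCard (α.erase N).degree | IsHorizontalStrip ν μ})]
  · refine Finset.sum_congr rfl fun ν hν => ?_
    rw [Finset.mem_filter, mem_withCard] at hν
    rw [← ncard_below_eq h hμ hν.1 hν.2, ← Set.ncard_coe_finset]
    congr 1
    ext T
    simp
  · intro T hT
    rw [Finset.mem_coe, Set.Finite.mem_toFinset, Set.mem_ofPred_eq] at hT
    subst hT
    have hs := isHorizontalStrip_below h
    rw [Finset.mem_coe, Finset.mem_filter, mem_withCard]
    exact ⟨by rw [← content_restrict h hs.1 rfl, degree_content], hs⟩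

theorem kostka_eq_zero {α : ℕ →₀ ℕ} (h : μ.card ≠ α.degree) : kostka μ α = 0 := by
  rw [kostka, Set.ncard_eq_zero (finite_content_eq μ α), Set.eq_empty_iff_forall_notMem]
  rintro T rfl
  exact h T.degree_content.symm

theorem kostka_bot : kostka ⊥ 0 = 1 := by
  rw [kostka, Set.ncard_eq_one]
  refine ⟨default, Set.eq_singleton_iff_unique_mem.2 ⟨by simp [content], fun T _ => ?_⟩⟩
  ext i j
  rw [zeros _ (notMem_bot _), zeros _ (notMem_bot _)]

/-- The expansion of a product of terms of a sequence into Jacobi–Trudi determinants. -/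
theorem prod_eq_sum_kostka_mul_jacobiTrudi {R : Type*} [CommRing R] {a : ℤ → R} (h0 : a 0 = 1)
    (hneg : ∀ s < 0, a s = 0) {N : ℕ} {α : ℕ →₀ ℕ} (hα : α.support ⊆ Finset.range N) :
    ∏ k ∈ Finset.range N, a (α k)
      = ∑ μ ∈ withCard α.degree, (kostka μ α : R) * μ.jacobiTrudi a := by
  classical
  induction N generalizing α with
  | zero =>
    obtain rfl : α = 0 := by simpa using hα
    have : withCard 0 = {⊥} := by
      ext μ
      rw [mem_withCard, Finset.mem_singleton, Finset.card_eq_zero]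
      exact ⟨fun h => YoungDiagram.ext h, fun h => h ▸ rfl⟩
    have hcol : (⊥ : YoungDiagram).colLen 0 ≤ 0 := by
      rw [← not_lt, ← mem_iff_lt_colLen]
      exact notMem_bot _
    rw [map_zero, this, Finset.sum_singleton, kostka_bot, jacobiTrudi_eq_of_colLen_le h0 hneg _ hcol]
    simp [_root_.jacobiTrudi]
  | succ N ih =>
    have hsub : (α.erase N).support ⊆ Finset.range N := fun k hk => by
      rw [Finsupp.support_erase, Finset.mem_erase] at hk
      have := Finset.mem_range.1 (hα hk.2)
      rw [Finset.mem_range]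
      omega
    have hdeg : α.degree = (α.erase N).degree + α N := by
      conv_lhs => rw [← Finsupp.erase_add_single N α]
      simp
    have hprod : ∏ k ∈ Finset.range N, a (α k) = ∏ k ∈ Finset.range N, a (α.erase N k) :=
      Finset.prod_congr rfl fun k hk => by
        rw [Finsupp.erase_ne (Finset.mem_range.1 hk).ne]
    rw [Finset.prod_range_succ, hprod, ih hsub, Finset.sum_mul]
    have h1 : ∀ ν ∈ withCard (α.erase N).degree,
        (kostka ν (α.erase N) : R) * ν.jacobiTrudi a * a (α N)
          = ∑ μ ∈ withCard α.degree, if IsHorizontalStrip ν μ then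
              (kostka ν (α.erase N) : R) * μ.jacobiTrudi a else 0 := fun ν hν => by
      rw [mul_assoc, mul_comm (ν.jacobiTrudi a), mul_jacobiTrudi h0 hneg, mem_withCard.1 hν, ← hdeg,
        Finset.mul_sum, Finset.sum_filter]
    -- For fixed `μ`, the sum over `ν` is now the recursion `kostka_eq_sum`.
    rw [Finset.sum_congr rfl h1, Finset.sum_comm]
    refine Finset.sum_congr rfl fun μ hμ => ?_
    rw [kostka_eq_sum hα (mem_withCard.1 hμ), Nat.cast_sum, Finset.sum_mul, Finset.sum_filter]

end SemistandardYoungTableau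

end

/-! ### The coefficients of `q_n` -/

noncomputable section

namespace HallLittlewood

theorem coeff_X_pow_mul_of_support_subset {ι : Type*} {s : Finset ι} {a : ι} (ha : a ∉ s)
    {P : MvPolynomial ι ℂ} (hP : ∀ d, ¬ d.support ⊆ s → P.coeff d = 0) (k : ℕ) (d : ι →₀ ℕ) :
    (MvPolynomial.X a ^ k * P).coeff d = if d a = k then P.coeff (d.erase a) else 0 := by
  classical
  rw [MvPolynomial.X_pow_eq_monomial, MvPolynomial.coeff_monomial_mul', one_mul]
  simp only [Finsupp.single_le_iff]
  rcases lt_trichotomy (d a) k with h | h | h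
  · rw [if_neg h.not_ge, if_neg h.ne]
  · rw [if_pos h.ge, if_pos h, ← h]
    congr 1
    conv_lhs => rw [← Finsupp.erase_add_single a d]
    simp
  · rw [if_pos h.le, if_neg h.ne']
    refine hP _ fun hs => ha (hs ?_)
    rw [Finsupp.mem_support_iff, Finsupp.tsub_apply, Finsupp.single_eq_same]
    omega

/-- The three terms of the recurrence `qPolySucc_insert` contribute to disjoint sets of monomials:
the exponent of `x_a` is `0`, between `1` and `n`, or `n + 1`. The last two terms carry the factor
`1 - t` that accounts for the new variable. -/
theorem coeff_qPolySucc {ι : Type*} [DecidableEq ι] (t : ℂ) (s : Finset ι) (n : ℕ) (d : ι →₀ ℕ) :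
    (qPolySucc t s n).coeff d
      = if d.degree = n + 1 ∧ d.support ⊆ s then (1 - t) ^ d.support.card else 0 := by
  induction s using Finset.induction_on generalizing n d with
  | empty =>
    have h0 : qPolySucc t (∅ : Finset ι) n = 0 := by
      apply IsFractionRing.injective (MvPolynomial ι ℂ) (FractionRing (MvPolynomial ι ℂ))
      rw [algebraMap_qPolySucc, map_zero]
      simp [qRat, qFormula]
    rw [h0, MvPolynomial.coeff_zero, if_neg]
    rintro ⟨h1, h2⟩
    rw [Finset.subset_empty, Finsupp.support_eq_empty] at h2
    simp [h2] at h1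
  | insert a s ha ih =>
    have hP : ∀ m (d : ι →₀ ℕ), ¬ d.support ⊆ s → (qPolySucc t s m).coeff d = 0 :=
      fun m d hd => by rw [ih, if_neg fun h => hd h.2]
    have hdeg : d.degree = (d.erase a).degree + d a := by
      conv_lhs => rw [← Finsupp.erase_add_single a d]
      simp
    have hsub : (d.erase a).support ⊆ s ↔ d.support ⊆ insert a s := by
      rw [Finsupp.support_erase, Finset.subset_insert_iff]
    rw [qPolySucc_insert t s a ha, ← map_one MvPolynomial.C, ← map_sub, MvPolynomial.coeff_add,
      MvPolynomial.coeff_add, MvPolynomial.coeff_C_mul, MvPolynomial.coeff_C_mul,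
      MvPolynomial.coeff_sum, MvPolynomial.coeff_X_pow]
    simp only [coeff_X_pow_mul_of_support_subset ha (hP _), ih, hsub]
    by_cases hs : d.support ⊆ insert a s
    swap
    · rw [if_neg fun h => hs (h.2.trans (Finset.subset_insert a s)),
        if_neg (c := Finsupp.single a (n + 1) = d), if_neg fun h => hs h.2, Finset.sum_eq_zero]
      · simp
      · intro m _
        simp [hs]
      · rintro rfl
        exact hs (Finsupp.support_single_subset.trans (by simp))
    rcases Nat.eq_zero_or_pos (d a) with h0 | hpos
    · have hs' : d.support ⊆ s := by
        rw [Finset.subset_insert_iff, Finset.erase_eq_of_notMem (by simpa using h0)] at hs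
        exact hs
      rw [Finset.sum_eq_zero, if_neg (c := Finsupp.single a (n + 1) = d)]
      · simp [hs, hs']
      · rintro rfl
        simp at h0
      · intro m hm
        rw [Finset.mem_range] at hm
        rw [if_neg (by omega)]
    · have hs' : ¬ d.support ⊆ s := fun h => ha (h (by simpa using hpos.ne'))
      have hcard : d.support.card = (d.erase a).support.card + 1 := by
        rw [Finsupp.support_erase, Finset.card_erase_add_one (by simpa using hpos.ne')]
      simp only [hs, hs', and_true, and_false, if_false, zero_add]
      have hsingle : Finsupp.single a (n + 1) = d ↔ (d.degree = n + 1 ∧ d a = n + 1) := by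
        constructor
        · rintro rfl
          simp
        · rintro ⟨h1, h2⟩
          have h3 : (d.erase a).degree = 0 := by omega
          rw [Finsupp.degree_eq_zero_iff] at h3
          rw [← Finsupp.erase_add_single a d, h3, zero_add, h2]
      simp only [hsingle]
      by_cases hd : d.degree = n + 1
      swap
      · rw [if_neg fun h => hd h.1, if_neg hd, Finset.sum_eq_zero]
        · simp
        · intro m hm
          rw [Finset.mem_range] at hm
          split_ifs with h1 h2
          · omega
          · rfl
          · rfl
      rw [if_pos hd]
      by_cases hda : d a = n + 1
      · rw [if_pos ⟨hd, hda⟩, Finset.sum_eq_zero]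
        · have h3 : (d.erase a).degree = 0 := by omega
          rw [Finsupp.degree_eq_zero_iff] at h3
          rw [hcard, h3]
          simp
        · intro m hm
          rw [if_neg (by omega)]
      -- The exponent `n - m` of `x_a` must equal `d a`, which leaves degree `m + 1 = n + 1 - d a`
      -- for the other variables.
      · rw [if_neg fun h => hda h.2, Finset.sum_eq_single (n - d a)]
        · rw [if_pos (by omega), if_pos (by omega), hcard, pow_succ']
          simp
        · intro m hm hne
          rw [Finset.mem_range] at hm
          rw [if_neg (by omega)]
        · intro h
          rw [Finset.mem_range] at h
          omega

theorem coeff_q_natCast {ι : Type*} (t : ℂ) (n : ℕ) (d : ι →₀ ℕ) :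
    MvPowerSeries.coeff d (q ι t n) = if d.degree = n then (1 - t) ^ d.support.card else 0 := by
  classical
  cases n with
  | zero =>
    change MvPowerSeries.coeff d 1 = _
    rw [MvPowerSeries.coeff_one]
    simp only [Finsupp.degree_eq_zero_iff]
    refine if_ctx_congr Iff.rfl ?_ fun _ => rfl
    rintro rfl
    simp
  | succ n =>
    rw [coeff_q t n d d.support subset_rfl, coeff_qPolySucc]
    simp

end HallLittlewood

/-! ### Coefficients in two alphabets and in the product alphabet -/

namespace Alphabet

open Finsupp

/-- The exponent of `x ^ α y ^ β`. -/
def exponent (α β : ℕ →₀ ℕ) : ℕ ⊕ ℕ →₀ ℕ :=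
  α.mapDomain Sum.inl + β.mapDomain Sum.inr

theorem exponent_inl (α β : ℕ →₀ ℕ) (k : ℕ) : exponent α β (Sum.inl k) = α k := by
  rw [exponent, Finsupp.add_apply, mapDomain_apply Sum.inl_injective,
    mapDomain_of_notMem_range _ _ (by simp), add_zero]

theorem exponent_inr (α β : ℕ →₀ ℕ) (k : ℕ) : exponent α β (Sum.inr k) = β k := by
  rw [exponent, Finsupp.add_apply, mapDomain_apply Sum.inr_injective,
    mapDomain_of_notMem_range _ _ (by simp), zero_add]

theorem exponent_inj {α β α' β' : ℕ →₀ ℕ} :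
    exponent α β = exponent α' β' ↔ α = α' ∧ β = β' := by
  refine ⟨fun h => ⟨?_, ?_⟩, by rintro ⟨rfl, rfl⟩; rfl⟩
  · ext k
    rw [← exponent_inl α β, h, exponent_inl]
  · ext k
    rw [← exponent_inr α β, h, exponent_inr]

theorem exists_exponent (e : ℕ ⊕ ℕ →₀ ℕ) : ∃ α β, e = exponent α β := by
  refine ⟨e.comapDomain Sum.inl Sum.inl_injective.injOn,
    e.comapDomain Sum.inr Sum.inr_injective.injOn, ?_⟩
  ext (k | k)
  · rw [exponent_inl, comapDomain_apply]
  · rw [exponent_inr, comapDomain_apply]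

/-- The alphabets are disjoint, so `x ^ α y ^ β` splits in only one way into a monomial in `X` times
a monomial in `Y`. -/
theorem coeff_inX_mul_inY (f g : MvPowerSeries ℕ ℂ) (α β : ℕ →₀ ℕ) :
    MvPowerSeries.coeff (exponent α β) (inX f * inY g)
      = MvPowerSeries.coeff α f * MvPowerSeries.coeff β g := by
  classical
  rw [MvPowerSeries.coeff_mul, Finset.sum_eq_single (α.mapDomain Sum.inl, β.mapDomain Sum.inr)]
  · have h1 := MvPowerSeries.coeff_embDomain_rename (Function.Embedding.inl : ℕ ↪ ℕ ⊕ ℕ) f α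
    have h2 := MvPowerSeries.coeff_embDomain_rename (Function.Embedding.inr : ℕ ↪ ℕ ⊕ ℕ) g β
    rw [embDomain_eq_mapDomain] at h1 h2
    exact congrArg₂ _ h1 h2
  · rintro ⟨u, v⟩ huv hne
    rw [Finset.HasAntidiagonal.mem_antidiagonal] at huv
    by_cases hu : u ∈ Set.range (mapDomain (Function.Embedding.inl : ℕ ↪ ℕ ⊕ ℕ))
    swap
    · rw [inX, MvPowerSeries.coeff_rename_eq_zero _ _ hu, zero_mul]
    by_cases hv : v ∈ Set.range (mapDomain (Function.Embedding.inr : ℕ ↪ ℕ ⊕ ℕ))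
    swap
    · rw [inY, MvPowerSeries.coeff_rename_eq_zero _ _ hv, mul_zero]
    obtain ⟨α', rfl⟩ := hu
    obtain ⟨β', rfl⟩ := hv
    obtain ⟨rfl, rfl⟩ := exponent_inj.1 (huv : exponent α' β' = exponent α β)
    exact absurd rfl hne
  · intro h
    rw [Finset.HasAntidiagonal.mem_antidiagonal, exponent] at h
    exact absurd rfl h

/-- Viewing `d` as a matrix, the two `mapDomain`s are its row sums and its column sums. -/
theorem prod_prodVar_pow (d : ℕ × ℕ →₀ ℕ) :
    (d.prod fun p k => prodVar p ^ k)
      = MvPowerSeries.monomial (exponent (d.mapDomain Prod.fst) (d.mapDomain Prod.snd)) 1 := by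
  induction d using Finsupp.induction_linear with
  | zero => simp [exponent]
  | add f g hf hg =>
    rw [prod_add_index' (by simp) (by simp [pow_add]), hf, hg, MvPowerSeries.monomial_mul_monomial,
      one_mul]
    congr 2
    simp only [exponent, mapDomain_add]
    abel
  | single p k =>
    rw [prod_single_index (by simp), prodVar, MvPowerSeries.X, MvPowerSeries.X,
      MvPowerSeries.monomial_mul_monomial, MvPowerSeries.monomial_pow]
    simp [exponent, mapDomain_single]

theorem mapDomain_fst_uncurry (g : ℕ →₀ ℕ →₀ ℕ) (k : ℕ) :
    g.uncurry.mapDomain Prod.fst k = (g k).degree := by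
  rw [mapDomain, sum_uncurry_index, Finsupp.sum_apply]
  have h : ∀ (i : ℕ) (h : ℕ →₀ ℕ),
      (h.sum fun j m => single ((i, j) : ℕ × ℕ).1 m) k = if i = k then h.degree else 0 := by
    intro i h
    rw [Finsupp.sum_apply]
    simp only [single_apply]
    split_ifs
    · rfl
    · simp
  simp only [h]
  rw [Finsupp.sum_ite_eq']
  split_ifs with hk
  · rfl
  · rw [notMem_support_iff.1 hk, map_zero]

theorem mapDomain_snd_uncurry (g : ℕ →₀ ℕ →₀ ℕ) :
    g.uncurry.mapDomain Prod.snd = g.sum fun _ h => h := by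
  rw [mapDomain, sum_uncurry_index]
  simp only [sum_single]

theorem card_support_uncurry (g : ℕ →₀ ℕ →₀ ℕ) :
    g.uncurry.support.card = g.sum fun _ h => h.support.card := by
  rw [Finset.card_eq_sum_ones]
  exact (sum_uncurry_index g fun _ _ => 1).trans
    (Finset.sum_congr rfl fun k _ => (Finset.card_eq_sum_ones _).symm)

/-- Both sides sum `(1 - t) ^ (number of nonzero entries)` over matrices with row sums `α` and
column sums `β`. On the right, row `k` is the exponent chosen in the factor `q_{α_k}`. -/
theorem coeff_atXY_q (t : ℂ) (n : ℕ) (α β : ℕ →₀ ℕ) {N : ℕ} (hα : α.support ⊆ Finset.range N) :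
    MvPowerSeries.coeff (exponent α β) (atXY (HallLittlewood.q (ℕ × ℕ) t n))
      = if α.degree = n then
          MvPowerSeries.coeff β (∏ k ∈ Finset.range N, HallLittlewood.q ℕ t (α k)) else 0 := by
  classical
  rw [atXY, MvPowerSeries.coeff_subst hasSubst_prodVar]
  simp only [prod_prodVar_pow, MvPowerSeries.coeff_monomial, exponent_inj,
    HallLittlewood.coeff_q_natCast, smul_eq_mul]
  have hdeg : ∀ d : ℕ × ℕ →₀ ℕ, α = d.mapDomain Prod.fst → d.degree = α.degree := by
    rintro d rfl
    rw [degree_mapDomain]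
  split_ifs with hn
  swap
  · refine finsum_eq_zero_of_forall_eq_zero fun d => ?_
    split_ifs with h1 h2
    · exact absurd ((hdeg d h2.1).symm.trans h1) hn
    all_goals simp
  -- Currying presents a matrix as the family `g` of its rows, the form in which the coefficient of
  -- a product is indexed.
  rw [MvPowerSeries.coeff_prod, ← finsum_comp_equiv (curryEquiv (α := ℕ) (β := ℕ) (M := ℕ)).symm]
  simp only [HallLittlewood.coeff_q_natCast, curryEquiv_symm_apply]
  have hfst : ∀ g : ℕ →₀ ℕ →₀ ℕ, α = g.uncurry.mapDomain Prod.fst ↔ ∀ k, α k = (g k).degree :=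
    fun g => by simp only [Finsupp.ext_iff, mapDomain_fst_uncurry]
  have hsupp : ∀ g : ℕ →₀ ℕ →₀ ℕ, α = g.uncurry.mapDomain Prod.fst →
      g.support ⊆ Finset.range N := fun g hg k hk => by
    refine hα ?_
    rw [mem_support_iff] at hk ⊢
    rw [(hfst g).1 hg, Ne, degree_eq_zero_iff]
    exact hk
  rw [finsum_eq_finsetSum_of_support_subset (s := Finset.finsuppAntidiag (Finset.range N) β)]
  · refine Finset.sum_congr rfl fun g hg => ?_
    rw [Finset.mem_finsuppAntidiag] at hg
    obtain ⟨hg1, hg2⟩ := hg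
    have hsnd : β = g.uncurry.mapDomain Prod.snd := by
      rw [mapDomain_snd_uncurry, ← hg1]
      exact (sum_of_support_subset g hg2 (fun _ h => h) fun _ _ => rfl).symm
    by_cases h : α = g.uncurry.mapDomain Prod.fst
    · rw [if_pos ((hdeg _ h).trans hn), if_pos ⟨h, hsnd⟩, mul_one, card_support_uncurry,
        sum_of_support_subset _ hg2 _ (by simp), ← Finset.prod_pow_eq_pow_sum]
      exact Finset.prod_congr rfl fun k _ => (if_pos ((hfst g).1 h k).symm).symm
    · rw [if_neg (c := _ ∧ _) fun h' => h h'.1, mul_zero]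
      rw [hfst, not_forall] at h
      obtain ⟨k, hk⟩ := h
      refine (Finset.prod_eq_zero (i := k) ?_ (if_neg (Ne.symm hk))).symm
      -- A row with the wrong sum has index below `N`, since beyond `N` both `α k` and `g k` vanish.
      by_contra hkN
      rw [notMem_support_iff.1 fun h => hkN (hα h), notMem_support_iff.1 fun h => hkN (hg2 h)] at hk
      simp at hk
  · intro g hg
    rw [Function.mem_support] at hg
    have h := (right_ne_zero_of_mul hg)
    rw [Ne, ite_eq_right_iff, not_forall] at h
    obtain ⟨⟨h1, h2⟩, -⟩ := h
    rw [Finset.mem_coe, Finset.mem_finsuppAntidiag]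
    refine ⟨?_, hsupp g h1⟩
    rw [h2, mapDomain_snd_uncurry]
    exact (sum_of_support_subset g (hsupp g h1) (fun _ h => h) fun _ _ => rfl).symm

end Alphabet

end

/-! ### Comparison of coefficients -/

theorem mainTheorem4 (t : ℂ) (n : ℕ) :
    Alphabet.atXY (HallLittlewood.q (ℕ × ℕ) t n) =
      ∑ p : n.Partition,
        Alphabet.inX (schurFunction p.youngDiagram) *
          Alphabet.inY (HallLittlewood.S ℕ t p.youngDiagram) := by
  rw [YoungDiagram.sum_partition n fun μ =>
    Alphabet.inX (schurFunction μ) * Alphabet.inY (HallLittlewood.S ℕ t μ)]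
  ext e
  obtain ⟨α, β, rfl⟩ := Alphabet.exists_exponent e
  obtain ⟨N, hN⟩ := α.support.exists_nat_subset_range
  rw [Alphabet.coeff_atXY_q t n α β hN, map_sum]
  simp only [Alphabet.coeff_inX_mul_inY]
  have hS : ∀ μ, HallLittlewood.S ℕ t μ = μ.jacobiTrudi (HallLittlewood.q ℕ t) := fun _ => rfl
  have hs : ∀ μ, MvPowerSeries.coeff α (schurFunction μ)
      = (SemistandardYoungTableau.kostka μ α : ℂ) := fun _ => rfl
  simp only [hS, hs]
  split_ifs with hn
  · subst hn
    rw [SemistandardYoungTableau.prod_eq_sum_kostka_mul_jacobiTrudi (a := HallLittlewood.q ℕ t) rfl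
      (fun s hs => ?_) hN, map_sum]
    · refine Finset.sum_congr rfl fun μ _ => ?_
      -- The Kostka number is a natural multiple, so it passes through the coefficient map.
      rw [← nsmul_eq_mul, map_nsmul, nsmul_eq_mul]
    · obtain ⟨m, rfl⟩ := Int.eq_negSucc_of_lt_zero hs
      rfl
  · refine (Finset.sum_eq_zero fun μ hμ => ?_).symm
    rw [SemistandardYoungTableau.kostka_eq_zero, Nat.cast_zero, zero_mul]
    rw [YoungDiagram.mem_withCard.1 hμ]
    exact Ne.symm hn
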